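/- Let $\mathsf{Atm}$ be a set of propositional variables. Formulas are in negation normal form, $A ::= p \mid \bar p \mid A\wedge A \mid A\vee A \mid \Box A \mid \Diamond A$ with $p\in\mathsf{Atm}$; the negation $\bar A$ is defined by de Morgan duality and $A\supset B := \bar A\vee B$. For $X\subseteq\{n\in\mathbb N : n>1\}$ let $\mathsf K+\{\Diamond^nA\supset\Diamond A : n\in X\}$ be the Hilbert system given by all classical propositional tautologies, all formulas $\Box(A\supset B)\supset(\Box A\supset\Box B)$, all formulas $\Diamond^nA\supset\Diamond A$ with $n\in X$, modus ponens and necessitation. The completion of $X$ is $\hat X=\bigcup_{p\ge 0}X_p$, where $X_0=X$ and $X_{p+1}=X_p\cup\{m+n-1 : m,n\in X_p\}$. A nested sequent is a finite multiset of formulas and of boxed nested sequents $[\Delta]$; $\Gamma\{\ \}$ denotes a nested sequent with one hole, which may lie at any nesting depth, and $\Gamma\{\Delta\}$ the result of putting $\Delta$ into the hole. The (cut-free) system $\mathsf{nK}$ has the axioms $\Gamma\{p,\bar p\}$ with $p\in\mathsf{Atm}$ and the following rules: from $\Gamma\{A,B\}$ infer $\Gamma\{A\vee B\}$; from $\Gamma\{A\}$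 and $\Gamma\{B\}$ infer $\Gamma\{A\wedge B\}$; from $\Gamma\{[A]\}$ infer $\Gamma\{\Box A\}$; from $\Gamma\{\Diamond A,[A,\Delta]\}$ infer $\Gamma\{\Diamond A,[\Delta]\}$. For $n\ge1$, the rule $\Diamond_{\mathsf kn}$ is: from $\Gamma\{\Diamond A,[\Delta_1,[\dots,[\Delta_{n-1},[A,\Delta_n]]\dots]]\}$ infer $\Gamma\{\Diamond A,[\Delta_1,[\dots,[\Delta_{n-1},[\Delta_n]]\dots]]\}$. A sequent is provable in a system if it is the root of a finite tree of nested sequents built from the axioms by the rules of the system. Then for every $X\subseteq\{n\in\mathbb N : n>1\}$ and every formula $A$: if $\mathsf K+\{\Diamond^nB\supset\Diamond B : n\in X,\ B \text{ a formula}\}\vdash A$, then the sequent consisting of $A$ alone is provable, without the cut rule, in $\mathsf{nK}+\{\Diamond_{\mathsf kn} : n\in\hat X\}$. -/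

import Mathlib

universe u

namespace NestedModal

/-! ### Formulas in negation normal form -/

/-- Modal formulas in negation normal form over a set `Atm` of propositional variables. -/
inductive Formula (Atm : Type u) : Type u
  | atom (p : Atm)
  | natom (p : Atm)
  | and (A B : Formula Atm)
  | or (A B : Formula Atm)
  | box (A : Formula Atm)
  | dia (A : Formula Atm)

namespace Formula

variable {Atm : Type u}

/-- The negation of a formula, by de Morgan duality. -/
def neg : Formula Atm → Formula Atm
  | atom p => natom p
  | natom p => atom p
  | and A B => or (neg A) (neg B)
  | or A B => and (neg A) (neg B)
  | box A => dia (neg A)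
  | dia A => box (neg A)

/-- Implication `A ⊃ B`, defined as the disjunction of the negation of `A` with `B`. -/
def imp (A B : Formula Atm) : Formula Atm := or (neg A) B

/-- A Boolean valuation of formulas. Modal formulas are treated as if they were propositional
variables, but `◇` of the negation of `A`, being the negation of `□ A`, gets the opposite value. -/
structure IsValuation (v : Formula Atm → Bool) : Prop where
  and (A B : Formula Atm) : v (Formula.and A B) = (v A && v B)
  or (A B : Formula Atm) : v (Formula.or A B) = (v A || v B)
  neg (A : Formula Atm) : v (Formula.neg A) = !(v A)

/-- Classical propositional tautologies (in the modal language). -/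
def IsTautology (A : Formula Atm) : Prop :=
  ∀ v : Formula Atm → Bool, IsValuation v → v A = true

end Formula

/-! ### The Hilbert system for `K` with additional axioms -/

/-- `KProvable Ax A`: the formula `A` is a theorem of the modal logic `K` extended with all
formulas in `Ax` as axioms. -/
inductive KProvable {Atm : Type u} (Ax : Set (Formula Atm)) : Formula Atm → Prop
  | taut (A : Formula Atm) : A.IsTautology → KProvable Ax A
  | k (A B : Formula Atm) :
      KProvable Ax (((A.imp B).box).imp ((A.box).imp (B.box)))
  | ax (A : Formula Atm) : A ∈ Ax → KProvable Ax A
  | mp (A B : Formula Atm) : KProvable Ax (A.imp B) → KProvable Ax A → KProvable Ax B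
  | nec (A : Formula Atm) : KProvable Ax A → KProvable Ax A.box

/-- All instances of the quasi-transitivity axioms `◇ⁿ A ⊃ ◇ A` with `n ∈ X`. -/
def quasiTransAxioms (Atm : Type u) (X : Set ℕ) : Set (Formula Atm) :=
  {F | ∃ n ∈ X, ∃ A : Formula Atm, F = (Formula.dia^[n] A).imp A.dia}

/-! ### Nested sequents -/

/-- Ordered representatives of nested sequents: finite lists of formulas and boxed sequents. -/
inductive PreSequent (Atm : Type u) : Type u
  | nil
  | formula (A : Formula Atm) (Γ : PreSequent Atm)
  | boxed (Δ Γ : PreSequent Atm)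

namespace PreSequent

variable {Atm : Type u}

/-- Two representatives are equivalent if they differ only in the order of the elements, at any
level of nesting. -/
inductive Equiv : PreSequent Atm → PreSequent Atm → Prop
  | refl (Γ) : Equiv Γ Γ
  | symm {Γ Δ} : Equiv Γ Δ → Equiv Δ Γ
  | trans {Γ Δ Θ} : Equiv Γ Δ → Equiv Δ Θ → Equiv Γ Θ
  | formula (A) {Γ Γ'} : Equiv Γ Γ' → Equiv (formula A Γ) (formula A Γ')
  | boxed {Δ Δ' Γ Γ'} : Equiv Δ Δ' → Equiv Γ Γ' → Equiv (boxed Δ Γ) (boxed Δ' Γ')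
  | swapFF (A B Γ) : Equiv (formula A (formula B Γ)) (formula B (formula A Γ))
  | swapFB (A Δ Γ) : Equiv (formula A (boxed Δ Γ)) (boxed Δ (formula A Γ))
  | swapBB (Δ Θ Γ) : Equiv (boxed Δ (boxed Θ Γ)) (boxed Θ (boxed Δ Γ))

instance setoid (Atm : Type u) : Setoid (PreSequent Atm) where
  r := Equiv
  iseqv := ⟨Equiv.refl, Equiv.symm, Equiv.trans⟩

/-- Concatenation of the outermost lists. -/
def append : PreSequent Atm → PreSequent Atm → PreSequent Atm
  | nil, Δ => Δ
  | formula A Γ, Δ => formula A (append Γ Δ)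
  | boxed Θ Γ, Δ => boxed Θ (append Γ Δ)

theorem append_right (Γ : PreSequent Atm) {Δ Δ' : PreSequent Atm} (h : Equiv Δ Δ') :
    Equiv (append Γ Δ) (append Γ Δ') := by
  induction Γ with
  | nil => exact h
  | formula A Γ ih => exact Equiv.formula A ih
  | boxed Θ Γ _ ih => exact Equiv.boxed (Equiv.refl Θ) ih

theorem append_left {Γ Γ' : PreSequent Atm} (h : Equiv Γ Γ') (Δ : PreSequent Atm) :
    Equiv (append Γ Δ) (append Γ' Δ) := by
  induction h with
  | refl Γ => exact Equiv.refl _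
  | symm _ ih => exact Equiv.symm ih
  | trans _ _ ih₁ ih₂ => exact Equiv.trans ih₁ ih₂
  | formula A _ ih => exact Equiv.formula A ih
  | boxed h _ _ ih => exact Equiv.boxed h ih
  | swapFF A B Γ => exact Equiv.swapFF _ _ _
  | swapFB A Θ Γ => exact Equiv.swapFB _ _ _
  | swapBB Θ Ξ Γ => exact Equiv.swapBB _ _ _

end PreSequent

/-- A nested sequent: a finite multiset of formulas and boxed nested sequents. -/
def Sequent (Atm : Type u) : Type u := Quotient (PreSequent.setoid Atm)

namespace Sequent

variable {Atm : Type u}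

/-- The empty nested sequent. -/
def empty : Sequent Atm := Quotient.mk _ PreSequent.nil

/-- The nested sequent whose only element is the formula `A`. -/
def single (A : Formula Atm) : Sequent Atm := Quotient.mk _ (PreSequent.formula A PreSequent.nil)

/-- The nested sequent whose only element is the boxed sequent `[Δ]`. -/
def bracket : Sequent Atm → Sequent Atm :=
  Quotient.map (fun Δ => PreSequent.boxed Δ PreSequent.nil)
    (fun _ _ h => PreSequent.Equiv.boxed h (PreSequent.Equiv.refl _))

/-- The multiset union `Γ, Δ` of two nested sequents. -/
def union : Sequent Atm → Sequent Atm → Sequent Atm :=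
  Quotient.map₂ PreSequent.append
    (fun _ Γ' h _ _ h' =>
      PreSequent.Equiv.trans (PreSequent.append_left h _) (PreSequent.append_right Γ' h'))

instance : EmptyCollection (Sequent Atm) := ⟨empty⟩

instance : Add (Sequent Atm) := ⟨union⟩

/-- `chain [Δ₁, …, Δₙ] Θ` is the nested sequent `[Δ₁, [Δ₂, […, [Δₙ, Θ] …]]]` when `n ≥ 1`
(and `Θ` itself when `n = 0`). -/
def chain : List (Sequent Atm) → Sequent Atm → Sequent Atm
  | [], Θ => Θ
  | Δ :: Δs, Θ => bracket (Δ + chain Δs Θ)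

end Sequent

/-- Contexts with exactly one hole: `hole Γ` is `Γ, { }` and `boxed Γ C` is `Γ, [C{ }]`. -/
inductive Context (Atm : Type u) : Type u
  | hole (Γ : Sequent Atm)
  | boxed (Γ : Sequent Atm) (C : Context Atm)

/-- The nested sequent obtained by replacing the hole of a context by a nested sequent. -/
def Context.fill {Atm : Type u} : Context Atm → Sequent Atm → Sequent Atm
  | hole Γ, Δ => Γ + Δ
  | boxed Γ C, Δ => Γ + Sequent.bracket (C.fill Δ)

/-! ### Nested sequent systems -/

/-- A nested sequent system, given by the instances of its rules: `N Γs Γ` means that `Γ` follows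
from the list of premisses `Γs` by one rule application. -/
abbrev NestedSystem (Atm : Type u) : Type u := List (Sequent Atm) → Sequent Atm → Prop

/-- `Provable N Γ`: there is a proof of `Γ` in the system `N`, that is, a finite tree of nested
sequents with root `Γ`, each of which follows from its children by a rule of `N`. -/
inductive Provable {Atm : Type u} (N : NestedSystem Atm) : Sequent Atm → Prop
  | rule (Γs : List (Sequent Atm)) (Γ : Sequent Atm) :
      N Γs Γ → (∀ Δ ∈ Γs, Provable N Δ) → Provable N Γ

open Sequent Formula in
/-- The rules of the (cut-free) nested sequent system `nK`. -/
inductive nK {Atm : Type u} : List (Sequent Atm) → Sequent Atm → Prop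
  | id (C : Context Atm) (p : Atm) :
      nK [] (C.fill (single (atom p) + single (natom p)))
  | or (C : Context Atm) (A B : Formula Atm) :
      nK [C.fill (single A + single B)] (C.fill (single (Formula.or A B)))
  | and (C : Context Atm) (A B : Formula Atm) :
      nK [C.fill (single A), C.fill (single B)] (C.fill (single (Formula.and A B)))
  | box (C : Context Atm) (A : Formula Atm) :
      nK [C.fill (bracket (single A))] (C.fill (single (Formula.box A)))
  | dia (C : Context Atm) (A : Formula Atm) (Δ : Sequent Atm) :
      nK [C.fill (single (Formula.dia A) + bracket (single A + Δ))]
        (C.fill (single (Formula.dia A) + bracket Δ))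

open Sequent Formula in
/-- The modal propagation rule `◇ₖₙ` for `n ≥ 1`: from `Γ{◇A, [Δ₁, […, [Δₙ, A] …]]}` infer
`Γ{◇A, [Δ₁, […, [Δₙ] …]]}`. -/
inductive diaK {Atm : Type u} (n : ℕ) : List (Sequent Atm) → Sequent Atm → Prop
  | mk (hn : 1 ≤ n) (C : Context Atm) (A : Formula Atm) (Δs : List (Sequent Atm))
      (hlen : Δs.length = n) :
      diaK n [C.fill (single (dia A) + chain Δs (single A))]
        (C.fill (single (dia A) + chain Δs ∅))

/-- The set of rules `◇ₖₙ` with `n ∈ X`. -/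
def diaKRules {Atm : Type u} (X : Set ℕ) : NestedSystem Atm :=
  fun Γs Γ => ∃ n ∈ X, diaK n Γs Γ

/-- The system whose rules are those of `N` together with those of `M`. -/
def NestedSystem.plus {Atm : Type u} (N M : NestedSystem Atm) : NestedSystem Atm :=
  fun Γs Γ => N Γs Γ ∨ M Γs Γ

/-! ### Completion -/

/-- The stages `X₀ = X` and `Xₚ₊₁ = Xₚ ∪ {m + n - 1 : m, n ∈ Xₚ}` of the completion of `X`. -/
def completionStage (X : Set ℕ) : ℕ → Set ℕ
  | 0 => X
  | p + 1 => completionStage X p ∪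
      {k | ∃ m ∈ completionStage X p, ∃ n ∈ completionStage X p, k = m + n - 1}

/-- The completion of `X`, the union of its stages. -/
def completion (X : Set ℕ) : Set ℕ := ⋃ p : ℕ, completionStage X p

end NestedModal

/-!
Cut-free completeness gives the result: `K` with the axioms `◇ⁿA ⊃ ◇A` is sound for a class of
tree models in which an unprovable formula would be refuted.

A set of labelled formulas, whose labels are paths of formulas from a root, is consistent if each
of its finite subsets is realized by an unprovable sequent. Realization records only that a formula
occurs *or has already been decomposed*, so it survives reading a rule upwards, and no
admissibility of weakening, contraction or inversion is needed. A maximal consistent set is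
therefore saturated, and refutes all its formulas in the model whose accessibility relation
descends along paths of length `1` or of length in `X̂`. This relation is quasi-transitive because
composing `n ∈ X` steps of lengths `kᵢ` gives a path of length `n + ∑ (kᵢ - 1)`, and `X̂` is closed
under adding `k - 1` for `k ∈ X̂`.
-/

namespace NestedModal

variable {Atm : Type u}

namespace PreSequent

theorem append_nil (Γ : PreSequent Atm) : append Γ nil = Γ := by
  induction Γ with
  | nil => rfl
  | formula A Γ ih => exact congrArg (formula A) ih
  | boxed Θ Γ _ ih => exact congrArg (boxed Θ) ih

theorem append_assoc (Γ Δ Θ : PreSequent Atm) :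
    append (append Γ Δ) Θ = append Γ (append Δ Θ) := by
  induction Γ with
  | nil => rfl
  | formula A Γ ih => exact congrArg (formula A) ih
  | boxed Ξ Γ _ ih => exact congrArg (boxed Ξ) ih

theorem append_formula (A : Formula Atm) (Γ Δ : PreSequent Atm) :
    Equiv (append Γ (formula A Δ)) (formula A (append Γ Δ)) := by
  induction Γ with
  | nil => exact Equiv.refl _
  | formula B Γ ih => exact (Equiv.formula B ih).trans (Equiv.swapFF _ _ _)
  | boxed Θ Γ _ ih => exact (Equiv.boxed (Equiv.refl Θ) ih).trans (Equiv.swapFB _ _ _).symm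

theorem append_boxed (Θ Γ Δ : PreSequent Atm) :
    Equiv (append Γ (boxed Θ Δ)) (boxed Θ (append Γ Δ)) := by
  induction Γ with
  | nil => exact Equiv.refl _
  | formula B Γ ih => exact (Equiv.formula B ih).trans (Equiv.swapFB _ _ _)
  | boxed Ξ Γ _ ih => exact (Equiv.boxed (Equiv.refl Ξ) ih).trans (Equiv.swapBB _ _ _)

theorem append_comm (Γ Δ : PreSequent Atm) : Equiv (append Γ Δ) (append Δ Γ) := by
  induction Γ with
  | nil => rw [append_nil]; exact Equiv.refl _
  | formula B Γ ih => exact (Equiv.formula B ih).trans (append_formula _ _ _).symm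
  | boxed Θ Γ _ ih => exact (Equiv.boxed (Equiv.refl Θ) ih).trans (append_boxed _ _ _).symm

/-- The multiset of formulas at the outermost level of a representative. -/
def formulas : PreSequent Atm → Multiset (Formula Atm)
  | nil => 0
  | formula A Γ => A ::ₘ Γ.formulas
  | boxed _ Γ => Γ.formulas

/-- The multiset of sequents boxed at the outermost level of a representative. -/
def boxes : PreSequent Atm → Multiset (Sequent Atm)
  | nil => 0
  | formula _ Γ => Γ.boxes
  | boxed Δ Γ => Quotient.mk _ Δ ::ₘ Γ.boxes

theorem Equiv.formulas_eq {Γ Δ : PreSequent Atm} (h : Equiv Γ Δ) : Γ.formulas = Δ.formulas := by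
  induction h with
  | refl => rfl
  | symm _ ih => exact ih.symm
  | trans _ _ ih₁ ih₂ => exact ih₁.trans ih₂
  | formula A _ ih => exact congrArg (A ::ₘ ·) ih
  | boxed _ _ _ ih => exact ih
  | swapFF A B Γ => exact Multiset.cons_swap A B _
  | swapFB => rfl
  | swapBB => rfl

theorem Equiv.boxes_eq {Γ Δ : PreSequent Atm} (h : Equiv Γ Δ) : Γ.boxes = Δ.boxes := by
  induction h with
  | refl => rfl
  | symm _ ih => exact ih.symm
  | trans _ _ ih₁ ih₂ => exact ih₁.trans ih₂
  | formula _ _ ih => exact ih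
  | boxed hΔ _ _ ih => exact congrArg₂ (· ::ₘ ·) (Quotient.sound hΔ) ih
  | swapFF => rfl
  | swapFB => rfl
  | swapBB => exact Multiset.cons_swap _ _ _

end PreSequent

namespace Sequent

instance : Zero (Sequent Atm) := ⟨∅⟩

instance : AddCommMonoid (Sequent Atm) where
  add_assoc := by
    rintro ⟨Γ⟩ ⟨Δ⟩ ⟨Θ⟩
    exact congrArg (Quotient.mk _) (PreSequent.append_assoc Γ Δ Θ)
  zero_add := by
    rintro ⟨Γ⟩
    rfl
  add_zero := by
    rintro ⟨Γ⟩
    exact congrArg (Quotient.mk _) (PreSequent.append_nil Γ)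
  add_comm := by
    rintro ⟨Γ⟩ ⟨Δ⟩
    exact Quotient.sound (PreSequent.append_comm Γ Δ)
  nsmul := nsmulRec

theorem empty_eq_zero : (∅ : Sequent Atm) = 0 := rfl

@[elab_as_elim]
theorem induction {p : Sequent Atm → Prop} (zero : p 0)
    (single_add : ∀ A Γ, p Γ → p (single A + Γ))
    (bracket_add : ∀ Δ Γ, p Γ → p (bracket Δ + Γ)) (Γ : Sequent Atm) : p Γ := by
  obtain ⟨Γ⟩ := Γ
  induction Γ with
  | nil => exact zero
  | formula A Γ ih => exact single_add A (Quotient.mk _ Γ) ih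
  | boxed Δ Γ _ ih => exact bracket_add (Quotient.mk _ Δ) (Quotient.mk _ Γ) ih

/-- The multiset of formulas at the outermost level of a sequent. -/
def formulas : Sequent Atm → Multiset (Formula Atm) :=
  Quotient.lift PreSequent.formulas fun _ _ => PreSequent.Equiv.formulas_eq

/-- The multiset of sequents boxed at the outermost level of a sequent. -/
def boxes : Sequent Atm → Multiset (Sequent Atm) :=
  Quotient.lift PreSequent.boxes fun _ _ => PreSequent.Equiv.boxes_eq

@[simp] theorem formulas_zero : (0 : Sequent Atm).formulas = 0 := rfl

@[simp] theorem formulas_single (A : Formula Atm) : (single A).formulas = {A} := rfl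

@[simp] theorem formulas_bracket (Δ : Sequent Atm) : (bracket Δ).formulas = 0 := by
  obtain ⟨Δ⟩ := Δ
  rfl

@[simp] theorem formulas_add (Γ Δ : Sequent Atm) :
    (Γ + Δ).formulas = Γ.formulas + Δ.formulas := by
  obtain ⟨Γ⟩ := Γ
  obtain ⟨Δ⟩ := Δ
  change (Γ.append Δ).formulas = Γ.formulas + Δ.formulas
  induction Γ <;> simp [PreSequent.append, PreSequent.formulas, *]

@[simp] theorem boxes_zero : (0 : Sequent Atm).boxes = 0 := rfl

@[simp] theorem boxes_single (A : Formula Atm) : (single A).boxes = 0 := rfl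

@[simp] theorem boxes_bracket (Δ : Sequent Atm) : (bracket Δ).boxes = {Δ} := by
  obtain ⟨Δ⟩ := Δ
  rfl

@[simp] theorem boxes_add (Γ Δ : Sequent Atm) : (Γ + Δ).boxes = Γ.boxes + Δ.boxes := by
  obtain ⟨Γ⟩ := Γ
  obtain ⟨Δ⟩ := Δ
  change (Γ.append Δ).boxes = Γ.boxes + Δ.boxes
  induction Γ with
  | nil => exact (zero_add _).symm
  | formula _ _ ih => exact ih
  | boxed Θ _ _ ih =>
    exact (congrArg (Quotient.mk _ Θ ::ₘ ·) ih).trans (Multiset.cons_add _ _ _).symm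

theorem exists_eq_single_add {A : Formula Atm} {Γ : Sequent Atm} (h : A ∈ Γ.formulas) :
    ∃ Δ, Γ = single A + Δ := by
  induction Γ using Sequent.induction with
  | zero => simp at h
  | single_add B Γ ih =>
    obtain rfl | h : A = B ∨ A ∈ Γ.formulas := by simpa using h
    · exact ⟨Γ, rfl⟩
    · obtain ⟨Δ, rfl⟩ := ih h
      exact ⟨single B + Δ, add_left_comm _ _ _⟩
  | bracket_add Θ Γ ih =>
    obtain ⟨Δ, rfl⟩ := ih (by simpa using h)
    exact ⟨bracket Θ + Δ, add_left_comm _ _ _⟩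

theorem exists_eq_add_bracket {Θ Γ : Sequent Atm} (h : Θ ∈ Γ.boxes) :
    ∃ Δ, Γ = Δ + bracket Θ := by
  induction Γ using Sequent.induction with
  | zero => simp at h
  | single_add B Γ ih =>
    obtain ⟨Δ, rfl⟩ := ih (by simpa using h)
    exact ⟨single B + Δ, (add_assoc _ _ _).symm⟩
  | bracket_add Ξ Γ ih =>
    obtain rfl | h : Θ = Ξ ∨ Θ ∈ Γ.boxes := by simpa using h
    · exact ⟨Γ, add_comm _ _⟩
    · obtain ⟨Δ, rfl⟩ := ih h
      exact ⟨bracket Ξ + Δ, (add_assoc _ _ _).symm⟩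

end Sequent

namespace Context

/-- The nesting depth of the hole of a context. -/
def depth : Context Atm → ℕ
  | hole _ => 0
  | boxed _ C => C.depth + 1

/-- The context with `Δ` put beside the hole. -/
def extend : Context Atm → Sequent Atm → Context Atm
  | hole Γ, Δ => hole (Γ + Δ)
  | boxed Γ C, Δ => boxed Γ (C.extend Δ)

theorem depth_extend (C : Context Atm) (Δ : Sequent Atm) :
    (C.extend Δ).depth = C.depth := by
  induction C with
  | hole _ => rfl
  | boxed _ C ih => exact congrArg (· + 1) ih

theorem fill_extend (C : Context Atm) (Δ Θ : Sequent Atm) :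
    (C.extend Δ).fill Θ = C.fill (Θ + Δ) := by
  induction C with
  | hole Γ => simp only [extend, fill, add_assoc, add_comm Θ]
  | boxed Γ C ih => simp only [extend, fill, ih]

theorem exists_fill_eq_add_chain (C : Context Atm) :
    ∃ (Γ : Sequent Atm) (Δs : List (Sequent Atm)), Δs.length = C.depth ∧
      ∀ Θ, C.fill Θ = Γ + Sequent.chain Δs Θ := by
  induction C with
  | hole Γ => exact ⟨Γ, [], rfl, fun _ => rfl⟩
  | boxed Γ C ih =>
    obtain ⟨Δ, Δs, hlen, hfill⟩ := ih
    exact ⟨Γ, Δ :: Δs, congrArg (· + 1) hlen, fun Θ => by rw [fill, hfill, Sequent.chain]⟩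

end Context

/-- The cut-free system `nK` with the propagation rules `◇ₖₙ` for `n ∈ Y`. -/
abbrev nKDia (Atm : Type u) (Y : Set ℕ) : NestedSystem Atm := NestedSystem.plus nK (diaKRules Y)

section Rules

open Sequent

variable {Y : Set ℕ} {C C' : Context Atm} {A B : Formula Atm} {Δ : Sequent Atm}

theorem provable_of_nK {Γs : List (Sequent Atm)} {Γ : Sequent Atm} (h : nK Γs Γ)
    (hΓs : ∀ Δ ∈ Γs, Provable (nKDia Atm Y) Δ) : Provable (nKDia Atm Y) Γ :=
  .rule Γs Γ (.inl h) hΓs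

theorem provable_id {p : Atm} :
    Provable (nKDia Atm Y) (C.fill (single (.atom p) + single (.natom p) + Δ)) := by
  rw [← C.fill_extend]
  exact provable_of_nK (.id _ p) (by simp)

theorem provable_or (h : Provable (nKDia Atm Y) (C.fill (single A + single B + Δ))) :
    Provable (nKDia Atm Y) (C.fill (single (A.or B) + Δ)) := by
  rw [← C.fill_extend] at h ⊢
  exact provable_of_nK (.or _ A B) (by simpa using h)

theorem provable_and (hA : Provable (nKDia Atm Y) (C.fill (single A + Δ)))
    (hB : Provable (nKDia Atm Y) (C.fill (single B + Δ))) :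
    Provable (nKDia Atm Y) (C.fill (single (A.and B) + Δ)) := by
  rw [← C.fill_extend] at hA hB ⊢
  exact provable_of_nK (.and _ A B) (by simpa using ⟨hA, hB⟩)

theorem provable_box (h : Provable (nKDia Atm Y) (C.fill (bracket (single A) + Δ))) :
    Provable (nKDia Atm Y) (C.fill (single A.box + Δ)) := by
  rw [← C.fill_extend] at h ⊢
  exact provable_of_nK (.box _ A) (by simpa using h)

theorem provable_dia_chain {Δs : List (Sequent Atm)} (hne : Δs ≠ [])
    (hlen : Δs.length ∈ insert 1 Y)
    (h : Provable (nKDia Atm Y) (C.fill (single A.dia + chain Δs (single A)))) :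
    Provable (nKDia Atm Y) (C.fill (single A.dia + chain Δs ∅)) := by
  obtain hlen | hlen := hlen
  · obtain ⟨Δ, rfl⟩ := List.length_eq_one_iff.1 hlen
    simp only [chain, empty_eq_zero, add_zero] at h ⊢
    rw [add_comm Δ] at h
    exact provable_of_nK (.dia C A Δ) (by simpa using h)
  · exact .rule [_] _ (.inr ⟨_, hlen, .mk (List.length_pos_iff.2 hne) C A Δs rfl⟩)
      (by simpa using h)

theorem provable_dia (hA : A.dia ∈ (C'.fill Δ).formulas) (hne : C'.depth ≠ 0)
    (hlen : C'.depth ∈ insert 1 Y)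
    (h : Provable (nKDia Atm Y) (C.fill (C'.fill (single A + Δ)))) :
    Provable (nKDia Atm Y) (C.fill (C'.fill Δ)) := by
  obtain ⟨Γ, Δs, hΔs, hfill⟩ := (C'.extend Δ).exists_fill_eq_add_chain
  rw [C'.depth_extend] at hΔs
  have hΔs_ne : Δs ≠ [] := by
    rintro rfl
    exact hne hΔs.symm
  have hfill_zero : C'.fill Δ = Γ + chain Δs ∅ := by
    rw [← hfill, C'.fill_extend, empty_eq_zero, zero_add]
  have hAΓ : A.dia ∈ Γ.formulas := by
    obtain ⟨Θ, Θs, rfl⟩ := List.exists_cons_of_ne_nil hΔs_ne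
    simpa [hfill_zero, chain] using hA
  obtain ⟨Γ', rfl⟩ := exists_eq_single_add hAΓ
  rw [← C'.fill_extend, hfill, add_right_comm, ← C.fill_extend] at h
  rw [hfill_zero, add_right_comm, ← C.fill_extend]
  exact provable_dia_chain hΔs_ne (hΔs ▸ hlen) h

end Rules

/-- Sets of formulas labelled by the nodes of a tree. A node is given by the path from the root to
it, and an edge is named by the formula whose box creates it. -/
abbrev LabelledSet (Atm : Type u) : Type u := Set (List (Formula Atm) × Formula Atm)

/-- The labelled formulas at or below the node `w`, with labels relative to `w`. -/
def subtree (w : List (Formula Atm)) (T : LabelledSet Atm) : LabelledSet Atm :=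
  {x | (w ++ x.1, x.2) ∈ T}

theorem mem_subtree_nil {w : List (Formula Atm)} {A : Formula Atm} {T : LabelledSet Atm} :
    ([], A) ∈ subtree w T ↔ (w, A) ∈ T := by
  simp [subtree]

theorem subtree_insert (w u : List (Formula Atm)) (A : Formula Atm) (T : LabelledSet Atm) :
    subtree w (insert (w ++ u, A) T) = insert (u, A) (subtree w T) := by
  ext ⟨v, F⟩
  simp [subtree]

theorem subtree_insert_of_ne {C D : Formula Atm} (h : D ≠ C) (u : List (Formula Atm))
    (A : Formula Atm) (T : LabelledSet Atm) :
    subtree [D] (insert (C :: u, A) T) = subtree [D] T := by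
  ext ⟨v, F⟩
  simp [subtree, h]

/-- `Γ.Covers A`: the formula `A`, or enough of its parts, occurs in `Γ`. Unlike occurrence, this
is preserved when a rule is applied upwards to `A`. -/
def Sequent.Covers : Sequent Atm → Formula Atm → Prop
  | Γ, .atom p => .atom p ∈ Γ.formulas
  | Γ, .natom p => .natom p ∈ Γ.formulas
  | Γ, .and A B => .and A B ∈ Γ.formulas ∨ Γ.Covers A ∨ Γ.Covers B
  | Γ, .or A B => .or A B ∈ Γ.formulas ∨ Γ.Covers A ∧ Γ.Covers B
  | Γ, .box A => .box A ∈ Γ.formulas ∨ ∃ Δ ∈ Γ.boxes, Δ.Covers A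
  | Γ, .dia A => .dia A ∈ Γ.formulas

/-- `Realizes T Γ`: the labelled set `T` maps homomorphically into the tree of boxes of `Γ`, each
formula being covered at the image of its label; moreover the image of an edge named `C` leads to
a box that covers `C`. Distinct nodes may have the same image. -/
inductive Realizes : LabelledSet Atm → Sequent Atm → Prop
  | intro (T : LabelledSet Atm) (Γ : Sequent Atm) (f : Formula Atm → Sequent Atm)
      (covers : ∀ A, ([], A) ∈ T → Γ.Covers A)
      (box : ∀ C, (subtree [C] T).Nonempty → f C ∈ Γ.boxes ∧ (f C).Covers C)
      (child : ∀ C, (subtree [C] T).Nonempty → Realizes (subtree [C] T) (f C)) : Realizes T Γ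

theorem realizes_iff {T : LabelledSet Atm} {Γ : Sequent Atm} :
    Realizes T Γ ↔ (∀ A, ([], A) ∈ T → Γ.Covers A) ∧
      ∀ C, (subtree [C] T).Nonempty → ∃ Δ ∈ Γ.boxes, Δ.Covers C ∧ Realizes (subtree [C] T) Δ := by
  constructor
  · rintro ⟨_, _, f, covers, box, child⟩
    exact ⟨covers, fun C hC => ⟨f C, (box C hC).1, (box C hC).2, child C hC⟩⟩
  · rintro ⟨covers, h⟩
    choose! f hf using h
    exact ⟨T, Γ, f, covers, fun C hC => ⟨(hf C hC).1, (hf C hC).2.1⟩, fun C hC => (hf C hC).2.2⟩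

theorem Realizes.covers {T : LabelledSet Atm} {Γ : Sequent Atm} {w : List (Formula Atm)}
    {A : Formula Atm} (h : Realizes (subtree w T) Γ) (hA : (w, A) ∈ T) : Γ.Covers A :=
  (realizes_iff.1 h).1 A (mem_subtree_nil.2 hA)

theorem realizes_empty (Γ : Sequent Atm) : Realizes ∅ Γ :=
  realizes_iff.2 ⟨fun _ h => h.elim, fun _ ⟨_, h⟩ => h.elim⟩

theorem realizes_singleton {A : Formula Atm} {Γ : Sequent Atm} :
    Realizes {([], A)} Γ ↔ Γ.Covers A := by
  refine ⟨fun h => (realizes_iff.1 h).1 A rfl, fun h => realizes_iff.2 ⟨?_, ?_⟩⟩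
  · rintro B hB
    obtain rfl : B = A := congrArg Prod.snd hB
    exact h
  · rintro C ⟨x, hx⟩
    cases congrArg Prod.fst hx

theorem Realizes.subset {T U : LabelledSet Atm} {Γ : Sequent Atm} (h : Realizes T Γ)
    (hU : U ⊆ T) : Realizes U Γ := by
  induction h generalizing U with
  | intro T Γ f covers box _ ih =>
    exact .intro U Γ f (fun A hA => covers A (hU hA))
      (fun C hC => box C (hC.mono fun _ hx => hU hx))
      (fun C hC => ih C (hC.mono fun _ hx => hU hx) fun _ hx => hU hx)

namespace Sequent

variable {Γ Δ Θ : Sequent Atm} {A : Formula Atm}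

theorem covers_of_mem (h : A ∈ Γ.formulas) : Γ.Covers A := by
  cases A with
  | atom | natom | dia => exact h
  | and | or | box => exact .inl h

theorem Covers.of_formulas_boxes (hf : ∀ F ∈ Γ.formulas, Δ.Covers F)
    (hb : ∀ Θ ∈ Γ.boxes, ∃ Ξ ∈ Δ.boxes, ∀ F, Θ.Covers F → Ξ.Covers F) (h : Γ.Covers A) :
    Δ.Covers A := by
  induction A with
  | atom | natom | dia => exact hf _ h
  | and A B ihA ihB => exact h.elim (hf _) fun h => .inr (h.imp ihA ihB)
  | or A B ihA ihB => exact h.elim (hf _) fun h => .inr (h.imp ihA ihB)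
  | box A =>
    obtain h | ⟨Θ, hΘ, hA⟩ := h
    · exact hf _ h
    · obtain ⟨Ξ, hΞ, hcov⟩ := hb Θ hΘ
      exact .inr ⟨Ξ, hΞ, hcov A hA⟩

/-- `Γ ≤ Δ` if `Δ` realizes every labelled set that `Γ` realizes. A sequent reached from `Γ` by
reading rules upwards is above `Γ` in this preorder, whereas it need not contain `Γ`. -/
instance : Preorder (Sequent Atm) where
  le Γ Δ := ∀ T, Realizes T Γ → Realizes T Δ
  le_refl _ _ := id
  le_trans _ _ _ h₁ h₂ T h := h₂ T (h₁ T h)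

theorem Covers.mono (h : Γ ≤ Δ) (hA : Γ.Covers A) : Δ.Covers A :=
  realizes_singleton.1 (h _ (realizes_singleton.2 hA))

theorem le_of_formulas_boxes (hf : ∀ F ∈ Γ.formulas, Δ.Covers F)
    (hb : ∀ Θ ∈ Γ.boxes, ∃ Ξ ∈ Δ.boxes, Θ ≤ Ξ) : Γ ≤ Δ := by
  intro T hT
  rw [realizes_iff] at hT ⊢
  refine ⟨fun A hA => Covers.of_formulas_boxes hf (fun Θ hΘ => ?_) (hT.1 A hA), fun C hC => ?_⟩
  · exact (hb Θ hΘ).imp fun Ξ hΞ => ⟨hΞ.1, fun F => Covers.mono hΞ.2⟩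
  · obtain ⟨Θ, hΘ, hcov, hr⟩ := hT.2 C hC
    obtain ⟨Ξ, hΞ, hle⟩ := hb Θ hΘ
    exact ⟨Ξ, hΞ, hcov.mono hle, hle _ hr⟩

theorem single_add_le (h : (Θ + Γ).Covers A) : single A + Γ ≤ Θ + Γ := by
  refine le_of_formulas_boxes (fun F hF => ?_) (fun Ξ hΞ => ⟨Ξ, ?_, le_rfl⟩)
  · obtain rfl | hF : F = A ∨ F ∈ Γ.formulas := by simpa using hF
    · exact h
    · exact covers_of_mem (by simp [hF])
  · have : Ξ ∈ Γ.boxes := by simpa using hΞ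
    simp [this]

theorem le_add_left (Γ Θ : Sequent Atm) : Γ ≤ Θ + Γ :=
  le_of_formulas_boxes (fun _ hF => covers_of_mem (by simp [hF]))
    fun Ξ hΞ => ⟨Ξ, by simp [hΞ], le_rfl⟩

theorem add_bracket_mono (Γ : Sequent Atm) (h : Δ ≤ Θ) : Γ + bracket Δ ≤ Γ + bracket Θ := by
  refine le_of_formulas_boxes (fun F hF => covers_of_mem (by simpa using hF)) (fun Ξ hΞ => ?_)
  obtain hΞ | rfl : Ξ ∈ Γ.boxes ∨ Ξ = Δ := by simpa using hΞ
  · exact ⟨Ξ, by simp [hΞ], le_rfl⟩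
  · exact ⟨Θ, by simp, h⟩

end Sequent

section Realization

open Sequent

variable {T : LabelledSet Atm} {Γ Δ : Sequent Atm} {A : Formula Atm}
  {u w : List (Formula Atm)}

theorem Realizes.insert_nil (h : Realizes T Γ) (hA : Γ.Covers A) :
    Realizes (insert ([], A) T) Γ := by
  rw [realizes_iff] at h ⊢
  refine ⟨?_, fun C => ?_⟩
  · rintro B (hB | hB)
    · obtain rfl : B = A := congrArg Prod.snd hB
      exact hA
    · exact h.1 B hB
  · have : subtree [C] (insert ([], A) T) = subtree [C] T := by
      ext
      simp [subtree]
    exact this ▸ h.2 C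

theorem Realizes.insert_child {C : Formula Atm} (h : Realizes T Γ) (hΔ : Δ ∈ Γ.boxes)
    (hC : Δ.Covers C) (hA : Realizes (insert (u, A) (subtree [C] T)) Δ) :
    Realizes (insert (C :: u, A) T) Γ := by
  rw [realizes_iff] at h ⊢
  refine ⟨?_, fun D => ?_⟩
  · rintro B (hB | hB)
    · cases congrArg Prod.fst hB
    · exact h.1 B hB
  · obtain rfl | hD := eq_or_ne D C
    · exact fun _ => ⟨Δ, hΔ, hC, (subtree_insert [D] u A T).symm ▸ hA⟩
    · rw [subtree_insert_of_ne hD]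
      exact h.2 D

theorem Realizes.insert_box (h : Realizes T Γ) (hΔ : Δ ∈ Γ.boxes) (hA : Δ.Covers A) :
    Realizes (insert ([A], A) T) Γ := by
  obtain hT | hT := (subtree [A] T).eq_empty_or_nonempty
  · exact h.insert_child hΔ hA (hT ▸ (realizes_empty Δ).insert_nil hA)
  · obtain ⟨Θ, hΘ, hcov, hr⟩ := (realizes_iff.1 h).2 A hT
    exact h.insert_child hΘ hcov (hr.insert_nil hcov)

theorem Realizes.exists_fill (h : Realizes T Γ) (hw : (subtree w T).Nonempty) :
    ∃ (C : Context Atm) (Δ : Sequent Atm), Γ = C.fill Δ ∧ C.depth = w.length ∧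
      Realizes (subtree w T) Δ ∧
      ∀ Δ', Δ ≤ Δ' → C.fill Δ ≤ C.fill Δ' ∧ ∀ u A,
        Realizes (insert (u, A) (subtree w T)) Δ' →
          Realizes (insert (w ++ u, A) T) (C.fill Δ') := by
  induction w generalizing T Γ with
  | nil =>
    refine ⟨.hole 0, Γ, (zero_add _).symm, rfl, h, fun Δ' hle => ?_⟩
    simp only [Context.fill, zero_add]
    exact ⟨hle, fun _ _ => id⟩
  | cons D w ih =>
    obtain ⟨Θ, hΘ, hD, hr⟩ := (realizes_iff.1 h).2 D (hw.elim fun x hx => ⟨(w ++ x.1, x.2), hx⟩)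
    obtain ⟨C, Δ, rfl, hdepth, hΔ, hC⟩ := ih hr hw
    obtain ⟨Γ, rfl⟩ := exists_eq_add_bracket hΘ
    refine ⟨.boxed Γ C, Δ, rfl, congrArg (· + 1) hdepth, hΔ, fun Δ' hle => ?_⟩
    obtain ⟨hfill, hins⟩ := hC Δ' hle
    have hbracket := add_bracket_mono Γ hfill
    exact ⟨hbracket, fun u A hA =>
      (hbracket _ h).insert_child (by simp) (hD.mono hfill) (hins u A hA)⟩

end Realization

section Inversion

open Sequent

variable {Y : Set ℕ} {C : Context Atm} {A B : Formula Atm} {Δ : Sequent Atm}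

theorem exists_covers_of_covers_and (h : ¬ Provable (nKDia Atm Y) (C.fill Δ))
    (hAB : Δ.Covers (A.and B)) :
    ∃ Δ', Δ ≤ Δ' ∧ ¬ Provable (nKDia Atm Y) (C.fill Δ') ∧ (Δ'.Covers A ∨ Δ'.Covers B) := by
  obtain hAB | hAB := hAB
  · obtain ⟨Δ, rfl⟩ := exists_eq_single_add hAB
    have hA : (single A + Δ).Covers A := covers_of_mem (by simp)
    have hB : (single B + Δ).Covers B := covers_of_mem (by simp)
    obtain hunp | hunp := not_and_or.1 fun hp => h (provable_and hp.1 hp.2)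
    · exact ⟨_, single_add_le (.inr (.inl hA)), hunp, .inl hA⟩
    · exact ⟨_, single_add_le (.inr (.inr hB)), hunp, .inr hB⟩
  · exact ⟨Δ, le_rfl, h, hAB⟩

theorem exists_covers_of_covers_or (h : ¬ Provable (nKDia Atm Y) (C.fill Δ))
    (hAB : Δ.Covers (A.or B)) :
    ∃ Δ', Δ ≤ Δ' ∧ ¬ Provable (nKDia Atm Y) (C.fill Δ') ∧ Δ'.Covers A ∧ Δ'.Covers B := by
  obtain hAB | hAB := hAB
  · obtain ⟨Δ, rfl⟩ := exists_eq_single_add hAB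
    have hcov : (single A + single B + Δ).Covers A ∧ (single A + single B + Δ).Covers B :=
      ⟨covers_of_mem (by simp), covers_of_mem (by simp)⟩
    exact ⟨_, single_add_le (.inr hcov), fun hp => h (provable_or hp), hcov⟩
  · exact ⟨Δ, le_rfl, h, hAB⟩

theorem exists_covers_of_covers_box (h : ¬ Provable (nKDia Atm Y) (C.fill Δ))
    (hA : Δ.Covers A.box) :
    ∃ Δ', Δ ≤ Δ' ∧ ¬ Provable (nKDia Atm Y) (C.fill Δ') ∧ ∃ Θ ∈ Δ'.boxes, Θ.Covers A := by
  obtain hA | hA := hA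
  · obtain ⟨Δ, rfl⟩ := exists_eq_single_add hA
    have hcov : ∃ Θ ∈ (bracket (single A) + Δ).boxes, Θ.Covers A :=
      ⟨single A, by simp, covers_of_mem (by simp)⟩
    exact ⟨_, single_add_le (.inr hcov), fun hp => h (provable_box hp), hcov⟩
  · exact ⟨Δ, le_rfl, h, hA⟩

end Inversion

/-- `T` is realized by a sequent that is unprovable in `nK` with the rules `◇ₖₙ` for `n ∈ Y`. -/
def Realizable (Y : Set ℕ) (T : LabelledSet Atm) : Prop :=
  ∃ Γ, ¬ Provable (nKDia Atm Y) Γ ∧ Realizes T Γ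

namespace Realizable

open Sequent

variable {Y : Set ℕ} {T U : LabelledSet Atm} {A B F : Formula Atm} {w l : List (Formula Atm)}

theorem subset (h : Realizable Y T) (hU : U ⊆ T) : Realizable Y U :=
  h.imp fun _ hΓ => hΓ.imp_right fun hT => hT.subset hU

theorem exists_fill (h : Realizable Y T) (hA : (w, A) ∈ T) :
    ∃ (C : Context Atm) (Δ : Sequent Atm), ¬ Provable (nKDia Atm Y) (C.fill Δ) ∧
      Realizes (subtree w T) Δ ∧
      ∀ Δ', Δ ≤ Δ' → ¬ Provable (nKDia Atm Y) (C.fill Δ') → ∀ u B,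
        Realizes (insert (u, B) (subtree w T)) Δ' → Realizable Y (insert (w ++ u, B) T) := by
  obtain ⟨Γ, hΓ, hT⟩ := h
  obtain ⟨C, Δ, rfl, -, hΔ, hC⟩ := hT.exists_fill ⟨_, mem_subtree_nil.2 hA⟩
  exact ⟨C, Δ, hΓ, hΔ, fun Δ' hle hunp u B hB => ⟨_, hunp, (hC Δ' hle).2 u B hB⟩⟩

theorem natom_notMem {p : Atm} (h : Realizable Y T) (hp : (w, .atom p) ∈ T) :
    (w, .natom p) ∉ T := by
  intro hn
  obtain ⟨C, Δ, hunp, hΔ, -⟩ := h.exists_fill hp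
  have hpΔ : .atom p ∈ Δ.formulas := hΔ.covers hp
  have hnΔ : .natom p ∈ Δ.formulas := hΔ.covers hn
  obtain ⟨Δ, rfl⟩ := exists_eq_single_add hpΔ
  obtain ⟨Δ, rfl⟩ := exists_eq_single_add (by simpa using hnΔ)
  exact hunp (add_assoc (single _) (single _) Δ ▸ provable_id)

theorem insert_and (h : Realizable Y T) (hAB : (w, A.and B) ∈ T) :
    Realizable Y (insert (w, A) T) ∨ Realizable Y (insert (w, B) T) := by
  obtain ⟨C, Δ, hunp, hΔ, hC⟩ := h.exists_fill hAB
  obtain ⟨Δ', hle, hunp', hcov⟩ := exists_covers_of_covers_and hunp (hΔ.covers hAB)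
  have hins (F : Formula Atm) (hF : Δ'.Covers F) : Realizable Y (insert (w, F) T) := by
    simpa using hC Δ' hle hunp' [] F ((hle _ hΔ).insert_nil hF)
  exact hcov.imp (hins A) (hins B)

theorem insert_or (h : Realizable Y T) (hAB : (w, A.or B) ∈ T) :
    Realizable Y (insert (w, A) T) ∧ Realizable Y (insert (w, B) T) := by
  obtain ⟨C, Δ, hunp, hΔ, hC⟩ := h.exists_fill hAB
  obtain ⟨Δ', hle, hunp', hcov⟩ := exists_covers_of_covers_or hunp (hΔ.covers hAB)
  have hins (F : Formula Atm) (hF : Δ'.Covers F) : Realizable Y (insert (w, F) T) := by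
    simpa using hC Δ' hle hunp' [] F ((hle _ hΔ).insert_nil hF)
  exact hcov.imp (hins A) (hins B)

theorem insert_box (h : Realizable Y T) (hA : (w, A.box) ∈ T) :
    Realizable Y (insert (w ++ [A], A) T) := by
  obtain ⟨C, Δ, hunp, hΔ, hC⟩ := h.exists_fill hA
  obtain ⟨Δ', hle, hunp', Θ, hΘ, hcov⟩ := exists_covers_of_covers_box hunp (hΔ.covers hA)
  exact hC Δ' hle hunp' [A] A ((hle _ hΔ).insert_box hΘ hcov)

theorem insert_dia (h : Realizable Y T) (hA : (w, A.dia) ∈ T) (hF : (w ++ l, F) ∈ T)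
    (hne : l ≠ []) (hl : l.length ∈ insert 1 Y) : Realizable Y (insert (w ++ l, A) T) := by
  obtain ⟨C, Δ, hunp, hΔ, hC⟩ := h.exists_fill hA
  obtain ⟨C', Δ, rfl, hdepth, hΔl, hC'⟩ := hΔ.exists_fill ⟨_, mem_subtree_nil.2 hF⟩
  have hle : Δ ≤ single A + Δ := le_add_left Δ (single A)
  refine hC _ (hC' _ hle).1 (fun hp => hunp ?_) l A ?_
  · exact provable_dia (hΔ.covers hA) (by simpa [hdepth] using hne) (hdepth ▸ hl) hp
  · simpa using (hC' _ hle).2 [] A ((hle _ hΔl).insert_nil (covers_of_mem (by simp)))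

end Realizable

/-- Every finite part of `S` is realizable. -/
def Consistent (Y : Set ℕ) (S : LabelledSet Atm) : Prop :=
  ∀ T ⊆ S, T.Finite → Realizable Y T

section Maximal

variable {Y : Set ℕ} {S : LabelledSet Atm}

theorem exists_maximal_consistent (hS : Consistent Y S) :
    ∃ S', S ⊆ S' ∧ Maximal (Consistent Y) S' := by
  have hfc : Order.IsOfFiniteCharacter {S : LabelledSet Atm | Consistent Y S} := fun S =>
    ⟨fun hS T hT _ U hU => hS U (hU.trans hT),
      fun hS T hT hfin => hS T hT hfin T subset_rfl hfin⟩
  exact hfc.exists_maximal hS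

theorem exists_mem_of_maximal_consistent (hS : Maximal (Consistent Y) S)
    {P E : LabelledSet Atm} (hPS : P ⊆ S) (hP : P.Finite) (hE : E.Finite)
    (hext : ∀ T, P ⊆ T → Realizable Y T → ∃ x ∈ E, Realizable Y (insert x T)) :
    ∃ x ∈ E, x ∈ S := by
  by_contra! hES
  have hbad (x) (hx : x ∈ E) : ∃ U ⊆ insert x S, U.Finite ∧ ¬ Realizable Y U := by
    by_contra! hcons
    exact hES x hx (hS.le_of_ge hcons (Set.subset_insert x S) (Set.mem_insert x S))
  choose! U hUS hUfin hU using hbad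
  have hT : P ∪ ⋃ x ∈ E, U x \ {x} ⊆ S := by
    refine Set.union_subset hPS (Set.iUnion₂_subset fun x hx => ?_)
    exact Set.sdiff_singleton_subset_iff.2 (hUS x hx)
  have hTfin : (P ∪ ⋃ x ∈ E, U x \ {x}).Finite :=
    hP.union (hE.biUnion fun x hx => (hUfin x hx).subset Set.sdiff_subset)
  obtain ⟨x, hx, hreal⟩ := hext _ Set.subset_union_left (hS.prop _ hT hTfin)
  refine hU x hx (hreal.subset (Set.sdiff_singleton_subset_iff.1 ?_))
  exact (Set.subset_biUnion_of_mem (u := fun x => U x \ {x}) hx).trans Set.subset_union_right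

theorem mem_of_maximal_consistent (hS : Maximal (Consistent Y) S) {P : LabelledSet Atm}
    {x : List (Formula Atm) × Formula Atm} (hPS : P ⊆ S) (hP : P.Finite)
    (hext : ∀ T, P ⊆ T → Realizable Y T → Realizable Y (insert x T)) : x ∈ S := by
  simpa using exists_mem_of_maximal_consistent (E := {x}) hS hPS hP (Set.finite_singleton x)
    (by simpa using hext)

end Maximal

theorem completionStage_mono (X : Set ℕ) : Monotone (completionStage X) :=
  monotone_nat_of_le_succ fun _ => Set.subset_union_left

theorem subset_completion (X : Set ℕ) : X ⊆ completion X :=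
  Set.subset_iUnion (completionStage X) 0

theorem add_sub_one_mem_completion {X : Set ℕ} {m n : ℕ} (hm : m ∈ completion X)
    (hn : n ∈ insert 1 (completion X)) : m + n - 1 ∈ completion X := by
  obtain rfl | hn := hn
  · exact hm
  · obtain ⟨p, hp⟩ := Set.mem_iUnion.1 hm
    obtain ⟨q, hq⟩ := Set.mem_iUnion.1 hn
    exact Set.mem_iUnion.2 ⟨max p q + 1, .inr ⟨m, completionStage_mono X (le_max_left p q) hp, n,
      completionStage_mono X (le_max_right p q) hq, rfl⟩⟩

/-- Satisfaction of a formula at a world of the Kripke model with accessibility relation `R` and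
valuation `V`. -/
def Sat {W : Type*} (R : W → W → Prop) (V : W → Atm → Prop) : W → Formula Atm → Prop
  | w, .atom p => V w p
  | w, .natom p => ¬ V w p
  | w, .and A B => Sat R V w A ∧ Sat R V w B
  | w, .or A B => Sat R V w A ∨ Sat R V w B
  | w, .box A => ∀ v, R w v → Sat R V v A
  | w, .dia A => ∃ v, R w v ∧ Sat R V v A

section Soundness

variable {W : Type*} {R : W → W → Prop} {V : W → Atm → Prop} {A B : Formula Atm}

theorem sat_neg {w : W} : Sat R V w A.neg ↔ ¬ Sat R V w A := by
  induction A generalizing w with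
  | atom => rfl
  | natom => simp [Formula.neg, Sat]
  | and A B ihA ihB => simp [Formula.neg, Sat, ihA, ihB, imp_iff_not_or]
  | or A B ihA ihB => simp [Formula.neg, Sat, ihA, ihB]
  | box A ih => simp [Formula.neg, Sat, ih]
  | dia A ih => simp [Formula.neg, Sat, ih]

theorem sat_imp {w : W} : Sat R V w (A.imp B) ↔ (Sat R V w A → Sat R V w B) := by
  simp [Formula.imp, Sat, sat_neg, imp_iff_not_or]

open Classical in
theorem isValuation_sat (w : W) :
    Formula.IsValuation fun A : Formula Atm => decide (Sat R V w A) where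
  and A B := by
    rw [Bool.eq_iff_iff]
    simp only [Bool.and_eq_true, decide_eq_true_eq]
    exact Iff.rfl
  or A B := by
    rw [Bool.eq_iff_iff]
    simp only [Bool.or_eq_true, decide_eq_true_eq]
    exact Iff.rfl
  neg A := by simp [sat_neg]

theorem sat_of_isTautology (h : A.IsTautology) (w : W) : Sat R V w A := by
  classical exact of_decide_eq_true (h _ (isValuation_sat w))

theorem sat_of_kProvable {Ax : Set (Formula Atm)} (hAx : ∀ A ∈ Ax, ∀ w, Sat R V w A)
    (h : KProvable Ax A) (w : W) : Sat R V w A := by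
  induction h generalizing w with
  | taut _ h => exact sat_of_isTautology h w
  | k A B =>
    rw [sat_imp, sat_imp]
    exact fun hAB hA v hv => sat_imp.1 (hAB v hv) (hA v hv)
  | ax A h => exact hAx A h w
  | mp A B _ _ ihAB ihA => exact sat_imp.1 (ihAB w) (ihA w)
  | nec _ _ ih => exact fun v _ => ih v

end Soundness

/-- The accessibility relation of the model associated with `S`: `v` occurs in `S` and lies below
`w`, at a distance that is `1` or in `Y`. -/
def TreeRel (Y : Set ℕ) (S : LabelledSet Atm) (w v : List (Formula Atm)) : Prop :=
  (∃ A, (v, A) ∈ S) ∧ ∃ l ≠ [], v = w ++ l ∧ l.length ∈ insert 1 Y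

section QuasiTransitivity

variable {X : Set ℕ} {S : LabelledSet Atm} {V : List (Formula Atm) → Atm → Prop}

theorem exists_sat_of_sat_iterate_dia {n : ℕ} {A : Formula Atm} {w : List (Formula Atm)}
    (h : Sat (TreeRel (completion X) S) V w (Formula.dia^[n] A)) :
    ∃ l, Sat (TreeRel (completion X) S) V (w ++ l) A ∧ n ≤ l.length ∧
      ∀ m ∈ completion X, m + l.length - n ∈ completion X := by
  induction n generalizing A with
  | zero => exact ⟨[], by simpa using h, le_rfl, fun m hm => hm⟩
  | succ n ih =>
    obtain ⟨l, ⟨_, ⟨-, k, hk, rfl, hkX⟩, hA⟩, hl, hlX⟩ := ih (A := A.dia) h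
    have hk_pos := List.length_pos_iff.2 hk
    refine ⟨l ++ k, by simpa using hA, ?_, fun m hm => ?_⟩
    · rw [List.length_append]
      omega
    · have hmem := add_sub_one_mem_completion (hlX m hm) hkX
      rwa [List.length_append, show m + (l.length + k.length) - (n + 1) =
        m + l.length - n + k.length - 1 by omega]

theorem sat_of_mem_quasiTransAxioms (hX : ∀ n ∈ X, n ≠ 0) {F : Formula Atm}
    (hF : F ∈ quasiTransAxioms Atm X) (w : List (Formula Atm)) :
    Sat (TreeRel (completion X) S) V w F := by
  obtain ⟨n, hn, A, rfl⟩ := hF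
  obtain ⟨n, rfl⟩ := Nat.exists_eq_succ_of_ne_zero (hX n hn)
  refine sat_imp.2 fun h => ?_
  obtain ⟨l, ⟨_, ⟨hv, k, hk, rfl, hkX⟩, hA⟩, hl, hlX⟩ :=
    exists_sat_of_sat_iterate_dia (A := A.dia) h
  have hmem := add_sub_one_mem_completion (hlX _ (subset_completion X hn)) hkX
  rw [show n.succ + l.length - n + k.length - 1 = l.length + k.length by omega,
    ← List.length_append] at hmem
  exact ⟨_, ⟨hv, l ++ k, by simp [hk], List.append_assoc w l k, .inr hmem⟩, hA⟩

end QuasiTransitivity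

/-- The closure conditions under which the model associated with `S` refutes the formulas of `S`
(a Hintikka set). -/
structure IsSaturated (Y : Set ℕ) (S : LabelledSet Atm) : Prop where
  natom_notMem {w p} : (w, .atom p) ∈ S → (w, .natom p) ∉ S
  and {w A B} : (w, .and A B) ∈ S → (w, A) ∈ S ∨ (w, B) ∈ S
  or {w A B} : (w, .or A B) ∈ S → (w, A) ∈ S ∧ (w, B) ∈ S
  box {w A} : (w, .box A) ∈ S → (w ++ [A], A) ∈ S
  dia {w v A} : (w, .dia A) ∈ S → TreeRel Y S w v → (v, A) ∈ S

section Completeness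

variable {Y : Set ℕ} {S : LabelledSet Atm} {A : Formula Atm}

theorem IsSaturated.not_sat (hS : IsSaturated Y S) {w : List (Formula Atm)} (hA : (w, A) ∈ S) :
    ¬ Sat (TreeRel Y S) (fun v p => (v, .natom p) ∈ S) w A := by
  induction A generalizing w with
  | atom p => exact hS.natom_notMem hA
  | natom p => exact not_not_intro hA
  | and A B ihA ihB => exact fun h => (hS.and hA).elim (ihA · h.1) (ihB · h.2)
  | or A B ihA ihB => exact not_or.2 ((hS.or hA).imp ihA ihB)
  | box A ih =>
    have hmem := hS.box hA
    exact fun h => ih hmem (h _ ⟨⟨A, hmem⟩, [A], by simp, rfl, .inl rfl⟩)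
  | dia A ih => exact fun ⟨_, hv, h⟩ => ih (hS.dia hA hv) h

theorem isSaturated_of_maximal_consistent (hS : Maximal (Consistent Y) S) : IsSaturated Y S where
  natom_notMem {w p} hp hn := by
    have hreal := hS.prop {(w, .atom p), (w, .natom p)} (Set.pair_subset hp hn) (Set.toFinite _)
    exact hreal.natom_notMem (.inl rfl) (.inr rfl)
  and {w A B} hAB := by
    simpa using exists_mem_of_maximal_consistent (E := {(w, A), (w, B)}) hS
      (Set.singleton_subset_iff.2 hAB) (Set.toFinite _) (Set.toFinite _)
      (fun T hT h => by simpa using h.insert_and (hT rfl))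
  or hAB :=
    ⟨mem_of_maximal_consistent hS (Set.singleton_subset_iff.2 hAB) (Set.toFinite _)
        fun _ hT h => (h.insert_or (hT rfl)).1,
      mem_of_maximal_consistent hS (Set.singleton_subset_iff.2 hAB) (Set.toFinite _)
        fun _ hT h => (h.insert_or (hT rfl)).2⟩
  box hA := mem_of_maximal_consistent hS (Set.singleton_subset_iff.2 hA) (Set.toFinite _)
    fun _ hT h => h.insert_box (hT rfl)
  dia := by
    rintro w _ A hA ⟨⟨F, hF⟩, l, hne, rfl, hl⟩
    exact mem_of_maximal_consistent hS (Set.pair_subset hA hF) (Set.toFinite _)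
      fun T hT h => h.insert_dia (hT (.inl rfl)) (hT (.inr rfl)) hne hl

theorem consistent_singleton (hA : ¬ Provable (nKDia Atm Y) (.single A)) :
    Consistent Y {([], A)} := by
  have hcov : (Sequent.single A).Covers A := Sequent.covers_of_mem (by simp)
  exact fun _ hT _ => ⟨_, hA, (realizes_singleton.2 hcov).subset hT⟩

theorem provable_single_of_sat
    (h : ∀ (S : LabelledSet Atm) (V : List (Formula Atm) → Atm → Prop), Sat (TreeRel Y S) V [] A) :
    Provable (nKDia Atm Y) (.single A) := by
  by_contra hA
  obtain ⟨S, hAS, hS⟩ := exists_maximal_consistent (consistent_singleton hA)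
  exact (isSaturated_of_maximal_consistent hS).not_sat (hAS rfl) (h S _)

end Completeness

end NestedModal

theorem corollary1 {Atm : Type u} (X : Set ℕ) (hX : X ⊆ {n : ℕ | 1 < n})
    (A : NestedModal.Formula Atm)
    (hA : NestedModal.KProvable (NestedModal.quasiTransAxioms Atm X) A) :
    NestedModal.Provable
      (NestedModal.NestedSystem.plus NestedModal.nK
        (NestedModal.diaKRules (NestedModal.completion X)))
      (NestedModal.Sequent.single A) :=
  NestedModal.provable_single_of_sat fun _ _ =>
    NestedModal.sat_of_kProvable
      (fun _ hF => NestedModal.sat_of_mem_quasiTransAxioms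
        (fun _ hn => (zero_lt_one.trans (hX hn)).ne') hF) hA []
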